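/- All graphs are finite, simple and undirected, and a graph class is a family of graphs closed under isomorphism. For a positive integer $k$, the $k$-th power $G^k$ of a graph $G$ has the same vertices as $G$, and two vertices are adjacent in $G^k$ if and only if their distance in $G$ is at least $1$ and at most $k$ (vertices in different components are at infinite distance). For a graph class $\mathcal G$ put $\mathcal G^k=\{G^k \mid G\in\mathcal G\}$. The clique-width $\mathrm{cw}(G)$ is the minimum number of different labels needed to construct a vertex-labeled graph isomorphic to $G$ by means of the following four operations: (i) creation of a new vertex with label $i$; (ii) disjoint union of two labeled graphs; (iii) joining by an edge each vertex with label $i$ to each vertex with label $j$, for a pair of different labels $i$ and $j$; (iv) relabeling each vertex with label $i$ with label $j$. (The graph with no vertices is given clique-width $0$.) Put $\mathrm{cw}(\mathcal G)=\sup\{\mathrm{cw}(G)\mid G\in\mathcal G\}$. The class $\mathcal G$ is of bounded clique-width if $\mathrm{cw}(\mathcal G)<\infty$, and it is of power-unbounded clique-width if there is no positive integer $k$ for which $\mathcal G^k$ is of bounded clique-width; that is, if $\mathrm{cw}(\mathcal G^k)=\infty$ for every $k\ge 1$. **Proposition.** Each of the following graph classes is of power-unbounded clique-width: 1. the bipartite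 permutation graphs, that is, the graphs that are bipartite and whose vertices can be enumerated as $v_1,\dots,v_n$ so that, for some permutation $\pi$ of $\{1,\dots,n\}$, $v_i$ and $v_j$ are adjacent if and only if $(\pi_i-\pi_j)(i-j)<0$; 2. the path powers, that is, the graphs isomorphic to $(P_n)^j$ for some $n\ge 1$ and $j\ge 1$, where $P_n$ is the path on $n$ vertices; 3. the unit interval graphs, that is, the intersection graphs of finite families of closed unit intervals on the real line; 4. the hypercube graphs, that is, the graphs isomorphic, for some $d\ge 1$, to the graph $Q_d$ whose vertices are the $2^d$ binary sequences of length $d$, two of them being adjacent if and only if they differ in exactly one coordinate. -/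

import Mathlib

/-- The `k`-th power of a graph `G`: two distinct vertices are adjacent when their distance in `G`
is at most `k` (vertices in different components are at distance `⊤`). -/
def graphPower {V : Type*} (G : SimpleGraph V) (k : ℕ) : SimpleGraph V where
  Adj u v := u ≠ v ∧ G.edist u v ≤ (k : ℕ∞)
  symm := ⟨fun u v h => ⟨h.1.symm, by rw [SimpleGraph.edist_comm]; exact h.2⟩⟩
  loopless := ⟨fun _ h => h.1 rfl⟩

theorem edist_iso_le {V W : Type*} {G : SimpleGraph V} {H : SimpleGraph W} (f : G ≃g H)
    (u v : V) : H.edist (f u) (f v) ≤ G.edist u v := by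
  refine le_iInf fun p => ?_
  exact (SimpleGraph.Walk.edist_le (p.map f.toHom)).trans (by simp)

theorem edist_iso {V W : Type*} {G : SimpleGraph V} {H : SimpleGraph W} (f : G ≃g H)
    (u v : V) : H.edist (f u) (f v) = G.edist u v :=
  le_antisymm (edist_iso_le f u v) (by simpa using edist_iso_le f.symm (f u) (f v))

/-- Isomorphic graphs have isomorphic powers. -/
def graphPowerIso {V W : Type*} {G : SimpleGraph V} {H : SimpleGraph W} (f : G ≃g H) (k : ℕ) :
    graphPower G k ≃g graphPower H k where
  toEquiv := f.toEquiv
  map_rel_iff' := by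
    intro u v
    change (f u ≠ f v ∧ H.edist (f u) (f v) ≤ k) ↔ (u ≠ v ∧ G.edist u v ≤ k)
    rw [edist_iso, f.injective.ne_iff]

/-- Expressions over the four clique-width operations with labels from the `k`-element
set `Fin k`. -/
inductive CWExpr (k : ℕ) : Type
  /-- creation of a single vertex with label `i` -/
  | vertex (i : Fin k) : CWExpr k
  /-- disjoint union of two labeled graphs -/
  | union (a b : CWExpr k) : CWExpr k
  /-- join each vertex with label `i` to each vertex with label `j`, for `i ≠ j` -/
  | join (i j : Fin k) (hij : i ≠ j) (a : CWExpr k) : CWExpr k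
  /-- give label `j` to each vertex with label `i` -/
  | relabel (i j : Fin k) (a : CWExpr k) : CWExpr k

namespace CWExpr

/-- The vertex set of the labeled graph built by an expression. -/
def Vert {k : ℕ} : CWExpr k → Type
  | vertex _ => Unit
  | union a b => a.Vert ⊕ b.Vert
  | join _ _ _ a => a.Vert
  | relabel _ _ a => a.Vert

/-- The labeling of the labeled graph built by an expression. -/
def label {k : ℕ} : (e : CWExpr k) → e.Vert → Fin k
  | vertex i => fun _ => i
  | union a b => Sum.elim a.label b.label
  | join _ _ _ a => a.label
  | relabel i j a => fun v => if a.label v = i then j else a.label v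

/-- The underlying graph of the labeled graph built by an expression. -/
def graph {k : ℕ} : (e : CWExpr k) → SimpleGraph e.Vert
  | vertex _ => ⊥
  | union a b => a.graph.sum b.graph
  | join i j _ a => a.graph ⊔ SimpleGraph.fromRel (fun u v => a.label u = i ∧ a.label v = j)
  | relabel _ _ a => a.graph

end CWExpr

/-- The clique-width of a graph: the least number of labels for which some expression builds a
labeled graph whose underlying graph is isomorphic to `G`. (The graph without vertices, which no
expression builds, gets the value `0`.) -/
noncomputable def cliqueWidth {V : Type} (G : SimpleGraph V) : ℕ :=
  sInf {k : ℕ | ∃ e : CWExpr k, Nonempty (e.graph ≃g G)}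

/-- A graph class: a family of finite simple graphs that is closed under isomorphism. -/
structure GraphClass where
  Mem : ∀ {V : Type} [Finite V], SimpleGraph V → Prop
  mem_of_iso : ∀ {V W : Type} [Finite V] [Finite W] {G : SimpleGraph V} {H : SimpleGraph W},
    G ≃g H → Mem G → Mem H

namespace GraphClass

/-- The class of all `k`-th powers of graphs in the class `𝒢`. -/
def power (𝒢 : GraphClass) (k : ℕ) : GraphClass where
  Mem {V} _ H := ∃ G : SimpleGraph V, 𝒢.Mem G ∧ graphPower G k = H
  mem_of_iso := by
    rintro V W _ _ _ H f ⟨G, hG, rfl⟩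
    refine ⟨G.map f.toEquiv.toEmbedding, 𝒢.mem_of_iso (SimpleGraph.Iso.map f.toEquiv G) hG, ?_⟩
    ext x y
    obtain ⟨u, rfl⟩ := f.surjective x
    obtain ⟨v, rfl⟩ := f.surjective y
    rw [f.map_adj_iff]
    exact (graphPowerIso (SimpleGraph.Iso.map f.toEquiv G) k).map_adj_iff (v := u) (w := v)

/-- The clique-width of a graph class: the supremum, possibly `⊤`, of the clique-widths of its
members. -/
noncomputable def cliqueWidth (𝒢 : GraphClass) : ℕ∞ :=
  ⨆ (V : Type) (_ : Finite V) (G : SimpleGraph V) (_ : 𝒢.Mem G), (_root_.cliqueWidth G : ℕ∞)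

def IsBoundedCliqueWidth (𝒢 : GraphClass) : Prop :=
  𝒢.cliqueWidth < ⊤

def IsPowerBoundedCliqueWidth (𝒢 : GraphClass) : Prop :=
  ∃ k : ℕ, 0 < k ∧ (𝒢.power k).IsBoundedCliqueWidth

def IsPowerUnboundedCliqueWidth (𝒢 : GraphClass) : Prop :=
  ¬ 𝒢.IsPowerBoundedCliqueWidth

end GraphClass

/-- `G` is a permutation graph: its vertices can be enumerated as `v₁, …, vₙ` so that for some
permutation `π` of the indices, `vᵢ` and `vⱼ` are adjacent if and only if
`(π i - π j) * (i - j) < 0`. -/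
def IsPermutationGraph {V : Type} (G : SimpleGraph V) : Prop :=
  ∃ (n : ℕ) (v : Fin n ≃ V) (π : Equiv.Perm (Fin n)), ∀ i j : Fin n,
    G.Adj (v i) (v j) ↔ (((π i : ℕ) : ℤ) - ((π j : ℕ) : ℤ)) * (((i : ℕ) : ℤ) - ((j : ℕ) : ℤ)) < 0

/-- `G` is the intersection graph of a family of (closed) unit intervals on the real line. -/
def IsUnitIntervalGraph {V : Type} (G : SimpleGraph V) : Prop :=
  ∃ a : V → ℝ, ∀ u v : V,
    G.Adj u v ↔ u ≠ v ∧ (Set.Icc (a u) (a u + 1) ∩ Set.Icc (a v) (a v + 1)).Nonempty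

/-- The `d`-dimensional hypercube graph: binary sequences of length `d`, adjacent when they differ
in exactly one coordinate. -/
def hypercubeGraph (d : ℕ) : SimpleGraph (Fin d → Bool) where
  Adj x y := hammingDist x y = 1
  symm := ⟨fun x y h => by rw [hammingDist_comm]; exact h⟩
  loopless := ⟨fun x h => by simp at h⟩

def bipartitePermutationGraphs : GraphClass where
  Mem G := G.IsBipartite ∧ IsPermutationGraph G
  mem_of_iso := by
    rintro V W _ _ G H f ⟨hb, n, v, π, h⟩
    refine ⟨SimpleGraph.Colorable.of_hom f.symm.toHom hb, n, v.trans f.toEquiv, π, fun i j => ?_⟩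
    rw [← h i j]
    exact f.map_adj_iff

/-- Path powers: all graphs isomorphic to `(Pₙ)ᵏ` for some `n ≥ 1`, `k ≥ 1`. -/
def pathPowers : GraphClass where
  Mem G := ∃ n k : ℕ, 1 ≤ n ∧ 1 ≤ k ∧ Nonempty (graphPower (SimpleGraph.pathGraph n) k ≃g G)
  mem_of_iso := by
    rintro V W _ _ G H f ⟨n, k, hn, hk, ⟨g⟩⟩
    exact ⟨n, k, hn, hk, ⟨g.trans f⟩⟩

def unitIntervalGraphs : GraphClass where
  Mem G := IsUnitIntervalGraph G
  mem_of_iso := by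
    rintro V W _ _ G H f ⟨a, h⟩
    refine ⟨fun w => a (f.symm w), fun u v => ?_⟩
    rw [← f.symm.map_adj_iff, h, f.symm.injective.ne_iff]

/-- Hypercube graphs: all graphs isomorphic to the `d`-dimensional hypercube graph for some
`d ≥ 1`. -/
def hypercubeGraphs : GraphClass where
  Mem G := ∃ d : ℕ, 1 ≤ d ∧ Nonempty (hypercubeGraph d ≃g G)
  mem_of_iso := by
    rintro V W _ _ G H f ⟨d, hd, ⟨g⟩⟩
    exact ⟨d, hd, ⟨g.trans f⟩⟩

/-! A construction with `k` labels contains a subexpression holding between one and two thirds of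
any prescribed finite vertex set with at least two elements. Vertices sharing a label there look
alike from outside, so the cut shows at most `k` neighbourhood types (`exists_balanced_cut_of_iso`).

Let the vertices be laid out in columns and rows so that edges are short. Crossing edges far apart
have endpoints of different types, so only `O(k)` columns are cut (`IsTypedCut.card_levels_le`).
Balance then leaves one column wholly inside and one wholly outside, and every row must be cut
somewhere between them. In a square grid this cuts too many rows (`le_of_grid`). In a chain of half
graphs, rows cut at the same place and in the same direction have different types, which bounds the
height by `6 * k * k` (`le_of_halfGraph_chain`).

The `k`-th power of a path power, or of its bipartite analogue, contains such a chain on every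
`k`-th column; path powers are also unit interval graphs. Powers of hypercubes contain grids whose
coordinates count ones. -/

/-! ### Balanced cuts from clique-width expressions -/

open Classical in
theorem Finset.card_filter_mem_image_inl {α β : Type*} (W : Finset (α ⊕ β)) (A : Set α) :
    (W.filter (· ∈ (Sum.inl '' A : Set (α ⊕ β)))).card = (W.toLeft.filter (· ∈ A)).card := by
  refine Eq.trans ?_ (Finset.card_map (Function.Embedding.inl : α ↪ α ⊕ β))
  congr 1
  ext (x | x) <;> simp

open Classical in
theorem Finset.card_filter_mem_image_inr {α β : Type*} (W : Finset (α ⊕ β)) (A : Set β) :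
    (W.filter (· ∈ (Sum.inr '' A : Set (α ⊕ β)))).card = (W.toRight.filter (· ∈ A)).card := by
  refine Eq.trans ?_ (Finset.card_map (Function.Embedding.inr : β ↪ α ⊕ β))
  congr 1
  ext (x | x) <;> simp

namespace CWExpr

theorem join_graph_adj {k : ℕ} {i j : Fin k} (hij : i ≠ j) (a : CWExpr k) (u v : a.Vert) :
    (join i j hij a).graph.Adj u v ↔ a.graph.Adj u v ∨ u ≠ v ∧
      ((a.label u = i ∧ a.label v = j) ∨ (a.label v = i ∧ a.label u = j)) := by
  change (a.graph ⊔ SimpleGraph.fromRel (fun u v => a.label u = i ∧ a.label v = j)).Adj u v ↔ _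
  rw [SimpleGraph.sup_adj, SimpleGraph.fromRel_adj]

open Classical in
/-- An expression whose marked vertices outnumber `2N/3` has a set of vertices, namely those of a
subexpression, with between `N/3` and `2N/3` marked vertices, on which the labels of the
subexpression determine both the final label and the adjacencies to the outside. -/
theorem exists_balanced_cut {k : ℕ} (N : ℕ) (hN : 2 ≤ N) (e : CWExpr k) (W : Finset e.Vert)
    (hW : 2 * N < 3 * W.card) :
    ∃ (A : Set e.Vert) (f : e.Vert → Fin k),
      N ≤ 3 * (W.filter (· ∈ A)).card ∧ 3 * (W.filter (· ∈ A)).card ≤ 2 * N ∧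
      ∀ u ∈ A, ∀ v ∈ A, f u = f v →
        e.label u = e.label v ∧ ∀ w ∉ A, (e.graph.Adj u w ↔ e.graph.Adj v w) := by
  induction e with
  | vertex i =>
    have : W.card ≤ 1 := Finset.card_le_one.2 fun a _ b _ => rfl
    omega
  | union a b iha ihb =>
    change Finset (a.Vert ⊕ b.Vert) at W
    change 2 * N < 3 * Finset.card (α := a.Vert ⊕ b.Vert) W at hW
    have hc : W.toLeft.card + W.toRight.card = W.card := Finset.card_toLeft_add_card_toRight
    have hl := W.card_filter_mem_image_inl
    have hr := W.card_filter_mem_image_inr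
    have left : (∃ (A : Set a.Vert) (f : a.Vert → Fin k),
        N ≤ 3 * (W.toLeft.filter (· ∈ A)).card ∧ 3 * (W.toLeft.filter (· ∈ A)).card ≤ 2 * N ∧
        ∀ u ∈ A, ∀ v ∈ A, f u = f v →
          a.label u = a.label v ∧ ∀ w ∉ A, (a.graph.Adj u w ↔ a.graph.Adj v w)) →
        ∃ (A : Set (a.Vert ⊕ b.Vert)) (f : a.Vert ⊕ b.Vert → Fin k),
        N ≤ 3 * (W.filter (· ∈ A)).card ∧ 3 * (W.filter (· ∈ A)).card ≤ 2 * N ∧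
        ∀ u ∈ A, ∀ v ∈ A, f u = f v →
          (union a b).label u = (union a b).label v ∧
            ∀ w ∉ A, ((union a b).graph.Adj u w ↔ (union a b).graph.Adj v w) := by
      rintro ⟨A, f, h1, h2, h3⟩
      -- The values of the type function on the other summand are arbitrary, since types are
      -- compared only on the cut set.
      refine ⟨Sum.inl '' A, Sum.elim f b.label, by rwa [hl], by rwa [hl], ?_⟩
      rintro _ ⟨u, hu, rfl⟩ _ ⟨v, hv, rfl⟩ huv
      obtain ⟨h4, h5⟩ := h3 u hu v hv huv
      refine ⟨h4, ?_⟩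
      rintro (w | w) hw
      · exact h5 w fun h => hw ⟨w, h, rfl⟩
      · exact Iff.rfl
    have right : (∃ (A : Set b.Vert) (f : b.Vert → Fin k),
        N ≤ 3 * (W.toRight.filter (· ∈ A)).card ∧ 3 * (W.toRight.filter (· ∈ A)).card ≤ 2 * N ∧
        ∀ u ∈ A, ∀ v ∈ A, f u = f v →
          b.label u = b.label v ∧ ∀ w ∉ A, (b.graph.Adj u w ↔ b.graph.Adj v w)) →
        ∃ (A : Set (a.Vert ⊕ b.Vert)) (f : a.Vert ⊕ b.Vert → Fin k),
        N ≤ 3 * (W.filter (· ∈ A)).card ∧ 3 * (W.filter (· ∈ A)).card ≤ 2 * N ∧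
        ∀ u ∈ A, ∀ v ∈ A, f u = f v →
          (union a b).label u = (union a b).label v ∧
            ∀ w ∉ A, ((union a b).graph.Adj u w ↔ (union a b).graph.Adj v w) := by
      rintro ⟨A, f, h1, h2, h3⟩
      refine ⟨Sum.inr '' A, Sum.elim a.label f, by rwa [hr], by rwa [hr], ?_⟩
      rintro _ ⟨u, hu, rfl⟩ _ ⟨v, hv, rfl⟩ huv
      obtain ⟨h4, h5⟩ := h3 u hu v hv huv
      refine ⟨h4, ?_⟩
      rintro (w | w) hw
      · exact Iff.rfl
      · exact h5 w fun h => hw ⟨w, h, rfl⟩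
    by_cases ha : 2 * N < 3 * W.toLeft.card
    · exact left (iha _ ha)
    by_cases hb : 2 * N < 3 * W.toRight.card
    · exact right (ihb _ hb)
    -- Neither side exceeds `2N/3`, and the larger one holds at least half of more than `2N/3`
    -- marked vertices: that whole side is the set, typed by its own labels.
    rcases le_total W.toLeft.card W.toRight.card with h | h
    · refine right ⟨Set.univ, b.label, ?_, ?_, fun u _ v _ huv => ⟨huv, fun w hw => ?_⟩⟩
      · simp only [Set.mem_univ, Finset.filter_true]; omega
      · simp only [Set.mem_univ, Finset.filter_true]; omega
      · exact absurd trivial hw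
    · refine left ⟨Set.univ, a.label, ?_, ?_, fun u _ v _ huv => ⟨huv, fun w hw => ?_⟩⟩
      · simp only [Set.mem_univ, Finset.filter_true]; omega
      · simp only [Set.mem_univ, Finset.filter_true]; omega
      · exact absurd trivial hw
  | join i j hij a ih =>
    obtain ⟨A, f, h1, h2, h3⟩ := ih W hW
    refine ⟨A, f, h1, h2, fun (u : a.Vert) hu (v : a.Vert) hv huv => ?_⟩
    obtain ⟨h4, h5⟩ := h3 u hu v hv huv
    refine ⟨h4, fun (w : a.Vert) hw => ?_⟩
    -- Equal labels persist through later operations, so a join treats `u` and `v` alike; its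
    -- distinctness condition is automatic for `w` outside `A`.
    have hu' : u ≠ w := fun h => hw (h ▸ hu)
    have hv' : v ≠ w := fun h => hw (h ▸ hv)
    refine (join_graph_adj hij a u w).trans (Iff.trans ?_ (join_graph_adj hij a v w).symm)
    rw [h5 w hw, h4]
    simp only [ne_eq, hu', hv', not_false_eq_true]
  | relabel i j a ih =>
    obtain ⟨A, f, h1, h2, h3⟩ := ih W hW
    refine ⟨A, f, h1, h2, fun (u : a.Vert) hu (v : a.Vert) hv huv => ?_⟩
    obtain ⟨h4, h5⟩ := h3 u hu v hv huv
    exact ⟨by simp only [label, h4], h5⟩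

end CWExpr

-- All of `I` is marked, with `N = I.card`; the upper bound of two thirds inside becomes a lower
-- bound of one third outside.
open Classical in
theorem exists_balanced_cut_of_iso {k : ℕ} {V ι : Type*} {G : SimpleGraph V} (e : CWExpr k)
    (g : e.graph ≃g G) (I : Finset ι) (hI : 2 ≤ I.card) (φ : ι → V) (hφ : Set.InjOn φ I) :
    ∃ (A : Set V) (f : V → Fin k),
      I.card ≤ 3 * (I.filter (φ · ∈ A)).card ∧ I.card ≤ 3 * (I.filter (φ · ∉ A)).card ∧
      ∀ u ∈ A, ∀ v ∈ A, f u = f v → ∀ w ∉ A, (G.Adj u w ↔ G.Adj v w) := by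
  have hinj : Set.InjOn (fun i => g.symm (φ i)) I := fun x hx y hy h =>
    hφ hx hy (g.symm.injective h)
  have hcard : (I.image fun i => g.symm (φ i)).card = I.card := Finset.card_image_of_injOn hinj
  obtain ⟨A, f, h1, h2, h3⟩ := e.exists_balanced_cut I.card hI (I.image fun i => g.symm (φ i))
    (by omega)
  have hA : ((I.image fun i => g.symm (φ i)).filter (· ∈ A)).card
      = (I.filter fun i => φ i ∈ g.symm ⁻¹' A).card := by
    rw [Finset.filter_image, Finset.card_image_of_injOn (hinj.mono (Finset.filter_subset _ _))]
    rfl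
  rw [hA] at h1 h2
  refine ⟨g.symm ⁻¹' A, f ∘ g.symm, h1, ?_, fun u hu v hv huv w hw => ?_⟩
  · have := Finset.card_filter_add_card_filter_not (s := I) (fun i => φ i ∈ g.symm ⁻¹' A)
    omega
  · rw [← g.symm.map_adj_iff, ← g.symm.map_adj_iff (v := v)]
    exact (h3 _ hu _ hv huv).2 _ hw

/-! ### Attaining the clique-width, and the reduction to single graphs -/

/-- A disjoint union of single vertices with pairwise distinct prescribed labels. -/
theorem exists_edgeless_expr {k : ℕ} (s : Finset (Fin k)) (hs : s.Nonempty) :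
    ∃ e : CWExpr k, e.graph = ⊥ ∧ Function.Injective e.label ∧ Set.range e.label = s := by
  induction hs using Finset.Nonempty.cons_induction with
  | singleton a =>
    refine ⟨.vertex a, rfl, fun x y _ => rfl, ?_⟩
    ext x
    constructor
    · rintro ⟨y, rfl⟩
      simp [CWExpr.label]
    · intro h
      exact ⟨(), by simpa [CWExpr.label, eq_comm] using h⟩
  | cons a s ha hs ih =>
    obtain ⟨e, h1, h2, h3⟩ := ih
    refine ⟨.union (.vertex a) e, ?_, ?_, ?_⟩
    · refine SimpleGraph.ext (funext fun u => funext fun v => ?_)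
      rcases u with u | u <;> rcases v with v | v
      · rfl
      · exact propext (iff_of_false Bool.false_ne_true (fun h => h))
      · exact propext (iff_of_false Bool.false_ne_true (fun h => h))
      · change e.graph.Adj u v = False
        rw [h1]
        rfl
    · have hne : ∀ v, e.label v ≠ a := fun v h => ha (by
        have : e.label v ∈ Set.range e.label := ⟨v, rfl⟩
        rw [h3, h] at this
        simpa using this)
      rintro (u | u) (v | v) h
      · rfl
      · exact absurd h.symm (hne v)
      · exact absurd h (hne u)
      · exact congrArg Sum.inr (h2 h)
    · change Set.range (Sum.elim (fun _ : Unit => a) e.label) = _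
      rw [Set.Sum.elim_range, h3]
      ext x
      simp

/-- Every graph on `Fin n`, `n ≠ 0`, is built by an expression over `n` labels. -/
theorem exists_expr_iso {n : ℕ} (hn : n ≠ 0) (G : SimpleGraph (Fin n)) :
    ∃ e : CWExpr n, Nonempty (e.graph ≃g G) := by
  classical
  have : NeZero n := ⟨hn⟩
  -- Every vertex keeps its own label, so a join adds no edge other than the one between the two
  -- vertices of the pair `p`.
  have key : ∀ s : Finset (Fin n × Fin n), (∀ p ∈ s, p.1 ≠ p.2) →
      ∃ e : CWExpr n, Function.Bijective e.label ∧
        ∀ u v, e.graph.Adj u v ↔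
          ((e.label u, e.label v) ∈ s ∨ (e.label v, e.label u) ∈ s) := by
    intro s
    induction s using Finset.induction_on with
    | empty =>
      intro _
      obtain ⟨e, h1, h2, h3⟩ := exists_edgeless_expr (Finset.univ : Finset (Fin n))
        Finset.univ_nonempty
      exact ⟨e, ⟨h2, Set.range_eq_univ.1 (by simpa using h3)⟩, by simp [h1]⟩
    | insert p s hp ih =>
      intro h
      obtain ⟨e, h1, h2⟩ := ih fun q hq => h q (Finset.mem_insert_of_mem hq)
      have hne := h p (Finset.mem_insert_self _ _)
      refine ⟨.join p.1 p.2 hne e, h1, fun (u v : e.Vert) => ?_⟩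
      refine (CWExpr.join_graph_adj hne e u v).trans ?_
      change _ ↔ ((e.label u, e.label v) ∈ insert p s ∨ (e.label v, e.label u) ∈ insert p s)
      rw [h2]
      simp only [Finset.mem_insert, Prod.ext_iff]
      have : (e.label u = p.1 ∧ e.label v = p.2 ∨ e.label v = p.1 ∧ e.label u = p.2) → u ≠ v := by
        rintro h rfl
        rcases h with h | h
        · exact hne (h.1.symm.trans h.2)
        · exact hne (h.1.symm.trans h.2)
      tauto
  obtain ⟨e, h1, h2⟩ := key (Finset.univ.filter fun p => G.Adj p.1 p.2)
    (fun p hp => (Finset.mem_filter.1 hp).2.ne)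
  refine ⟨e, ⟨Equiv.ofBijective _ h1, fun {u v} => ?_⟩⟩
  rw [h2]
  simp [G.adj_comm]

/-- The infimum is attained once its set is nonempty; without vertices the set would be empty and
`sInf` would return its default `0`. -/
theorem exists_expr_cliqueWidth {V : Type} [Finite V] [Nonempty V] (G : SimpleGraph V) :
    ∃ e : CWExpr (cliqueWidth G), Nonempty (e.graph ≃g G) := by
  have hne : {k : ℕ | ∃ e : CWExpr k, Nonempty (e.graph ≃g G)}.Nonempty := by
    obtain ⟨e, ⟨g⟩⟩ := exists_expr_iso (Nat.card_pos (α := V)).ne'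
      (G.map (Finite.equivFin V).toEmbedding)
    exact ⟨_, e, ⟨g.trans (SimpleGraph.Iso.map (Finite.equivFin V) G).symm⟩⟩
  exact Nat.sInf_mem hne

theorem GraphClass.isPowerUnboundedCliqueWidth_of_forall (𝒢 : GraphClass)
    (h : ∀ k K : ℕ, 0 < k → ∃ (V : Type) (_ : Finite V) (_ : Nonempty V)
      (G : SimpleGraph V), 𝒢.Mem G ∧ K < _root_.cliqueWidth (graphPower G k)) :
    𝒢.IsPowerUnboundedCliqueWidth := by
  rintro ⟨k, hk, hb⟩
  obtain ⟨K, hK⟩ := ENat.ne_top_iff_exists.1 hb.ne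
  obtain ⟨V, hV, _, G, hG, hlt⟩ := h k K hk
  have h1 : (_root_.cliqueWidth (graphPower G k) : ℕ∞) ≤ (𝒢.power k).cliqueWidth := by
    unfold GraphClass.cliqueWidth
    exact le_iSup_of_le V (le_iSup_of_le hV (le_iSup_of_le (graphPower G k)
      (le_iSup_of_le ⟨G, hG, rfl⟩ le_rfl)))
  rw [← hK] at h1
  exact absurd (by exact_mod_cast h1) (not_le.2 hlt)

/-! ### Typed cuts and the columns they cross -/

/-- The vertices of `A` have at most `k` neighbourhoods outside `A`, the neighbourhood of `u ∈ A`
outside `A` being determined by `f u : Fin k`. -/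
def IsTypedCut {V : Type*} (G : SimpleGraph V) {k : ℕ} (A : Set V) (f : V → Fin k) : Prop :=
  ∀ u ∈ A, ∀ v ∈ A, f u = f v → ∀ w ∉ A, (G.Adj u w ↔ G.Adj v w)

namespace IsTypedCut

variable {V : Type*} {G : SimpleGraph V} {k : ℕ} {A : Set V} {f : V → Fin k}

theorem ne_of_crossing (h : IsTypedCut G A f) {a b a' b' : V} (ha : a ∈ A) (hb : b ∉ A)
    (ha' : a' ∈ A) (hb' : b' ∉ A) (hab : G.Adj a b) (hab' : G.Adj a' b')
    (hn : ¬ G.Adj a b' ∨ ¬ G.Adj a' b) : f a ≠ f a' := by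
  intro he
  rcases hn with hn | hn
  · exact hn ((h a ha a' ha' he b' hb').2 hab')
  · exact hn ((h a ha a' ha' he b hb).1 hab)

/-- Few levels are crossed by an edge of the cut, when edges join only nearby levels. -/
theorem card_levels_le (h : IsTypedCut G A f) (l : V → ℕ) (s t : ℕ)
    (hl : ∀ u v, G.Adj u v → l u ≤ l v + t) (X : Finset ℕ)
    (hX : ∀ c ∈ X, ∃ x ∈ A, ∃ y, y ∉ A ∧ G.Adj x y ∧ c ≤ l x ∧ l x ≤ c + s ∧ c ≤ l y ∧
      l y ≤ c + s) : X.card ≤ k * (s + t + 1) := by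
  rcases X.eq_empty_or_nonempty with rfl | ⟨c₀, hc₀⟩
  · simp
  have : Nonempty V := ⟨(hX c₀ hc₀).choose⟩
  choose! a ha b hb hab h1 h2 h3 h4 using hX
  have hpos : 0 < s + t + 1 := by omega
  -- Levels in one residue class modulo `s + t + 1` are so far apart that the upper crossing edge
  -- has no endpoint adjacent to one of the lower edge. Hence their types differ, and each class has
  -- at most `k` levels.
  have hinj : Set.InjOn (fun c => (f (a c), (⟨c % (s + t + 1), Nat.mod_lt _ hpos⟩ :
      Fin (s + t + 1)))) X := by
    have key : ∀ c ∈ X, ∀ d ∈ X, c < d → f (a c) = f (a d) →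
        c % (s + t + 1) = d % (s + t + 1) → False := by
      intro c hc d hd hcd hf hm
      have hgap : c + (s + t + 1) ≤ d := by
        have : s + t + 1 ∣ d - c := (Nat.modEq_iff_dvd' hcd.le).1 hm
        have := Nat.le_of_dvd (by omega) this
        omega
      refine h.ne_of_crossing (ha c hc) (hb c hc) (ha d hd) (hb d hd) (hab c hc) (hab d hd)
        (Or.inr fun hadj => ?_) hf
      have e1 := hl _ _ hadj
      have e2 := h1 d hd
      have e3 := h4 c hc
      omega
    intro c hc d hd hcd
    simp only [Prod.mk.injEq, Fin.mk.injEq] at hcd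
    rcases lt_trichotomy c d with hlt | rfl | hlt
    · exact (key c hc d hd hlt hcd.1 hcd.2).elim
    · rfl
    · exact (key d hd c hc hlt hcd.1.symm hcd.2.symm).elim
  have := Finset.card_le_card_of_injOn (t := (Finset.univ : Finset (Fin k × Fin (s + t + 1)))) _
    (fun _ _ => Finset.mem_coe.2 (Finset.mem_univ _)) hinj
  simpa using this

end IsTypedCut

theorem exists_consecutive_change (P : ℕ → Prop) {n i j : ℕ} (hi : i < n) (hj : j < n)
    (hPi : P i) (hPj : ¬ P j) :
    ∃ c, c + 1 < n ∧ ((P c ∧ ¬ P (c + 1)) ∨ (¬ P c ∧ P (c + 1))) := by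
  by_contra! hcon
  have h0 : ∀ c, c < n → (P c ↔ P 0) := by
    intro c
    induction c with
    | zero => simp
    | succ c ih =>
      intro hc
      rw [← ih (by omega)]
      have := hcon c hc
      tauto
  exact hPj ((h0 j hj).2 ((h0 i hi).1 hPi))

open Classical in
/-- If at most `q` of the `M` columns of a grid meet both a set and its complement, and the
complement takes up a third of the grid, then some column is disjoint from the set. -/
theorem exists_column_forall_not {M m q : ℕ} (hm : 0 < m) (S : ℕ → ℕ → Prop) (X : Finset ℕ)
    (hX : ∀ c < M, (∃ r < m, S c r) → (∃ r < m, ¬ S c r) → c ∈ X) (hXq : X.card ≤ q)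
    (hM : 3 * q < M)
    (hS : M * m ≤ 3 * ((Finset.range M ×ˢ Finset.range m).filter fun p => ¬ S p.1 p.2).card) :
    ∃ c < M, ∀ r < m, ¬ S c r := by
  by_contra! hcon
  -- If every column met `S`, its complement would lie in the mixed columns, which cover less than a
  -- third of the grid.
  have hsub : ((Finset.range M ×ˢ Finset.range m).filter fun p => ¬ S p.1 p.2)
      ⊆ X ×ˢ Finset.range m := by
    intro p hp
    simp only [Finset.mem_filter, Finset.mem_product, Finset.mem_range] at hp ⊢
    exact ⟨hX _ hp.1.1 (hcon _ hp.1.1) ⟨_, hp.1.2, hp.2⟩, hp.1.2⟩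
  have h1 := Finset.card_le_card hsub
  rw [Finset.card_product, Finset.card_range] at h1
  have h2 : X.card * m ≤ q * m := Nat.mul_le_mul_right _ hXq
  have h3 : 3 * q * m < M * m := Nat.mul_lt_mul_of_pos_right hM hm
  nlinarith

open Classical in
theorem exists_full_columns {M m q : ℕ} (hm : 0 < m) (S : ℕ → ℕ → Prop) (X : Finset ℕ)
    (hX : ∀ c < M, (∃ r < m, S c r) → (∃ r < m, ¬ S c r) → c ∈ X) (hXq : X.card ≤ q)
    (hM : 3 * q < M)
    (hS : M * m ≤ 3 * ((Finset.range M ×ˢ Finset.range m).filter fun p => S p.1 p.2).card)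
    (hS' : M * m ≤ 3 * ((Finset.range M ×ˢ Finset.range m).filter fun p => ¬ S p.1 p.2).card) :
    (∃ c < M, ∀ r < m, S c r) ∧ ∃ c < M, ∀ r < m, ¬ S c r := by
  refine ⟨?_, exists_column_forall_not hm S X hX hXq hM hS'⟩
  simpa using exists_column_forall_not hm (fun c r => ¬ S c r) X
    (fun c hc h1 h2 => hX c hc (by simpa using h2) h1) hXq hM (by simpa using hS)

open Classical in
theorem exists_balanced_grid_cut {k : ℕ} {V : Type*} {G : SimpleGraph V} (e : CWExpr k)
    (g : e.graph ≃g G) {M m : ℕ} (hM : 2 ≤ M) (hm : 0 < m) (φ : ℕ → ℕ → V)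
    (hφ : ∀ c < M, ∀ r < m, ∀ c' < M, ∀ r' < m, φ c r = φ c' r' → c = c' ∧ r = r') :
    ∃ (A : Set V) (f : V → Fin k), IsTypedCut G A f ∧
      M * m ≤ 3 * ((Finset.range M ×ˢ Finset.range m).filter fun p => φ p.1 p.2 ∈ A).card ∧
      M * m ≤ 3 * ((Finset.range M ×ˢ Finset.range m).filter fun p => φ p.1 p.2 ∉ A).card := by
  have hc : (Finset.range M ×ˢ Finset.range m).card = M * m := by simp
  obtain ⟨A, f, h1, h2, h3⟩ := exists_balanced_cut_of_iso e g (Finset.range M ×ˢ Finset.range m)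
    (by rw [hc]; nlinarith) (fun p => φ p.1 p.2) (by
      rintro ⟨c, r⟩ hp ⟨c', r'⟩ hp' h
      simp only [Finset.coe_product, Set.mem_prod, Finset.coe_range, Set.mem_Iio] at hp hp'
      have := hφ _ hp.1 _ hp.2 _ hp'.1 _ hp'.2 h
      exact Prod.ext this.1 this.2)
  rw [hc] at h1 h2
  exact ⟨A, f, h3, h1, h2⟩

/-! ### Lower bounds from half-graph chains and from grids -/

open Classical in
/-- Graphs that contain a long chain of half graphs have large clique-width. -/
theorem le_of_halfGraph_chain {k : ℕ} {V : Type*} {G : SimpleGraph V} (e : CWExpr k)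
    (g : e.graph ≃g G) {M m L : ℕ} (hm : 0 < m) (hmL : m ≤ L) (F : V → ℕ)
    (hF : ∀ u v, G.Adj u v → F u ≤ F v + L) (φ : ℕ → ℕ → V)
    (hφ : ∀ c < M, ∀ r < m, F (φ c r) = c * L + r)
    (hadj : ∀ c r r', c + 1 < M → r < m → r' ≤ r → G.Adj (φ c r) (φ (c + 1) r'))
    (hM : 9 * k + 3 < M) : m ≤ 6 * k * k := by
  have hL : 0 < L := hm.trans_le hmL
  have hdiv : ∀ c < M, ∀ r < m, F (φ c r) / L = c := by
    intro c hc r hr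
    rw [hφ c hc r hr, Nat.mul_comm, Nat.mul_add_div hL, Nat.div_eq_of_lt (by omega), add_zero]
  have hnadj : ∀ c r r', c + 1 < M → r' < m → r < r' → ¬ G.Adj (φ c r) (φ (c + 1) r') := by
    intro c r r' hc hr' hrr h
    have := hF _ _ h.symm
    rw [hφ c (by omega) r (by omega), hφ _ hc r' hr', add_mul] at this
    omega
  obtain ⟨A, f, hA, hA1, hA2⟩ := exists_balanced_grid_cut e g (M := M) (by omega) hm φ (by
    intro c hc r hr c' hc' r' hr' h
    have h1 := hdiv c hc r hr
    rw [h, hdiv c' hc' r' hr'] at h1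
    subst h1
    have h2 := hφ _ hc r hr
    rw [h, hφ _ hc r' hr'] at h2
    exact ⟨rfl, by omega⟩)
  -- The indices `c` with a crossing edge inside columns `c` and `c + 1`. With level `F / L` and `s
  -- = t = 1` there are at most `3k` of them.
  set X : Finset ℕ := (Finset.range (M - 1)).filter fun c => ∃ x ∈ A, ∃ y, y ∉ A ∧ G.Adj x y ∧
    c ≤ F x / L ∧ F x / L ≤ c + 1 ∧ c ≤ F y / L ∧ F y / L ≤ c + 1 with hXdef
  have hXcard : X.card ≤ k * 3 := by
    refine hA.card_levels_le (fun v => F v / L) 1 1 (fun u v huv => ?_) X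
      fun c hc => (Finset.mem_filter.1 hc).2
    have := Nat.div_le_div_right (c := L) (hF u v huv)
    rwa [Nat.add_div_right _ hL] at this
  have hcross : ∀ c r r', c + 1 < M → r < m → r' ≤ r →
      ((φ c r ∈ A ∧ φ (c + 1) r' ∉ A) ∨ (φ c r ∉ A ∧ φ (c + 1) r' ∈ A)) → c ∈ X := by
    intro c r r' hc hr hr' h
    have e1 := hdiv c (by omega) r hr
    have e2 := hdiv (c + 1) hc r' (by omega)
    have e3 := hadj c r r' hc hr hr'
    refine Finset.mem_filter.2 ⟨Finset.mem_range.2 (by omega), ?_⟩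
    rcases h with h | h
    · exact ⟨_, h.1, _, h.2, e3, by omega⟩
    · exact ⟨_, h.2, _, h.1, e3.symm, by omega⟩
  -- The bottom vertex of column `c + 1` is adjacent to all of column `c`, so a mixed column yields
  -- a crossing edge. The last column has no successor and is simply added, whence `q = 3k + 1` and
  -- the bound `9k + 3 < M`.
  obtain ⟨⟨c₁, hc₁, h₁⟩, c₂, hc₂, h₂⟩ := exists_full_columns (M := M) (q := k * 3 + 1) hm
    (fun c r => φ c r ∈ A) (insert (M - 1) X) (by
      rintro c hc ⟨r, hr, hrA⟩ ⟨r', hr', hrA'⟩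
      rcases Nat.lt_or_ge (c + 1) M with hlt | hge
      · refine Finset.mem_insert_of_mem ?_
        by_cases h0 : φ (c + 1) 0 ∈ A
        · exact hcross c r' 0 hlt hr' (Nat.zero_le _) (Or.inr ⟨hrA', h0⟩)
        · exact hcross c r 0 hlt hr (Nat.zero_le _) (Or.inl ⟨hrA, h0⟩)
      · rw [show c = M - 1 by omega]
        exact Finset.mem_insert_self _ _) ((Finset.card_insert_le _ _).trans (by omega))
    (by omega) hA1 hA2
  have hstep : ∀ r < m, ∃ c, c + 1 < M ∧ ((φ c r ∈ A ∧ φ (c + 1) r ∉ A) ∨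
      (φ c r ∉ A ∧ φ (c + 1) r ∈ A)) := fun r hr =>
    exists_consecutive_change (fun c => φ c r ∈ A) hc₁ hc₂ (h₁ r hr) (h₂ r hr)
  choose! γ hγ hγ' using hstep
  -- Each row is encoded by where it is cut, which end lies in `A`, and the type of that end: `3k *
  -- 2 * k` codes. Two rows with one code are impossible, since the lower left vertex is not
  -- adjacent to the upper right one.
  have hcard : (Finset.range m).card ≤ (X ×ˢ (Finset.univ : Finset (Bool × Fin k))).card := by
    refine Finset.card_le_card_of_injOn
      (fun r => (γ r, if φ (γ r) r ∈ A then (true, f (φ (γ r) r))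
        else (false, f (φ (γ r + 1) r)))) ?_ ?_
    · intro r hr
      have hr' := Finset.mem_range.1 (Finset.mem_coe.1 hr)
      exact Finset.mem_coe.2 (Finset.mem_product.2
        ⟨hcross _ r r (hγ r hr') hr' le_rfl (hγ' r hr'), Finset.mem_univ _⟩)
    · have key : ∀ r r', r < r' → r' < m → γ r = γ r' →
          (if φ (γ r) r ∈ A then (true, f (φ (γ r) r)) else (false, f (φ (γ r + 1) r))) =
          (if φ (γ r') r' ∈ A then (true, f (φ (γ r') r')) else (false, f (φ (γ r' + 1) r'))) →
          False := by
        intro r r' hrr hr' hc h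
        have g1 := hγ' r (by omega)
        have g2 := hγ' r' hr'
        have g3 := hγ r' hr'
        rw [hc] at g1 h
        have a1 := hadj (γ r') r r g3 (by omega) le_rfl
        have a2 := hadj (γ r') r' r' g3 hr' le_rfl
        have a3 := hnadj (γ r') r r' g3 hr' hrr
        by_cases b1 : φ (γ r') r ∈ A <;> by_cases b2 : φ (γ r') r' ∈ A <;>
          simp only [b1, b2, if_true, if_false, Prod.mk.injEq, true_and, false_and,
            reduceCtorEq, not_true_eq_false, not_false_eq_true, or_false, false_or] at h g1 g2
        · exact hA.ne_of_crossing b1 g1 b2 g2 a1 a2 (Or.inl a3) h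
        · exact hA.ne_of_crossing g1 b1 g2 b2 a1.symm a2.symm (Or.inr fun h => a3 h.symm) h
      intro r hr r' hr' h
      have e1 := Finset.mem_range.1 (Finset.mem_coe.1 hr)
      have e2 := Finset.mem_range.1 (Finset.mem_coe.1 hr')
      simp only [Prod.mk.injEq] at h
      rcases lt_trichotomy r r' with hlt | rfl | hlt
      · exact (key r r' hlt e2 h.1 h.2).elim
      · rfl
      · exact (key r' r hlt e1 h.1.symm h.2.symm).elim
  rw [Finset.card_product, Finset.card_range] at hcard
  simp only [Finset.card_univ, Fintype.card_prod, Fintype.card_bool, Fintype.card_fin] at hcard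
  nlinarith [Nat.mul_le_mul_right (2 * k) hXcard]

open Classical in
/-- Graphs that contain a large square grid, in which only vertices at bounded distance are
adjacent, have large clique-width. -/
theorem le_of_grid {k : ℕ} {V : Type*} {G : SimpleGraph V} (e : CWExpr k)
    (g : e.graph ≃g G) {n t : ℕ} (φ : ℕ → ℕ → V) (p q : V → ℕ)
    (hp : ∀ u v, G.Adj u v → p u ≤ p v + t) (hq : ∀ u v, G.Adj u v → q u ≤ q v + t)
    (hpφ : ∀ x < n, ∀ y < n, p (φ x y) = x) (hqφ : ∀ x < n, ∀ y < n, q (φ x y) = y)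
    (hrow : ∀ x y, x + 1 < n → y < n → G.Adj (φ x y) (φ (x + 1) y))
    (hcol : ∀ x y, x < n → y + 1 < n → G.Adj (φ x y) (φ x (y + 1))) :
    n ≤ 3 * (k * (t + 1)) + 1 := by
  by_contra! hn
  obtain ⟨A, f, hA, hA1, hA2⟩ := exists_balanced_grid_cut e g (M := n) (m := n) (by omega)
    (by omega) φ (by
    intro c hc r hr c' hc' r' hr' h
    have h1 := hpφ c hc r hr
    have h2 := hqφ c hc r hr
    rw [h, hpφ c' hc' r' hr'] at h1
    rw [h, hqφ c' hc' r' hr'] at h2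
    exact ⟨h1.symm, h2.symm⟩)
  have hcard : ∀ l : V → ℕ, (∀ u v, G.Adj u v → l u ≤ l v + t) →
      ((Finset.range n).filter fun c => ∃ x ∈ A, ∃ y, y ∉ A ∧ G.Adj x y ∧ l x = c ∧ l y = c).card
        ≤ k * (t + 1) := by
    intro l hl
    refine (hA.card_levels_le l 0 t hl _ fun c hc => ?_).trans (by simp)
    obtain ⟨x, hx, y, hy, hxy, h1, h2⟩ := (Finset.mem_filter.1 hc).2
    exact ⟨x, hx, y, hy, hxy, by omega⟩
  have hcol' : ∀ c < n, (∃ r < n, φ c r ∈ A) → (∃ r < n, φ c r ∉ A) →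
      c ∈ (Finset.range n).filter fun c => ∃ x ∈ A, ∃ y, y ∉ A ∧ G.Adj x y ∧ p x = c ∧ p y = c := by
    rintro c hc ⟨r, hr, h1⟩ ⟨r', hr', h2⟩
    refine Finset.mem_filter.2 ⟨Finset.mem_range.2 hc, ?_⟩
    obtain ⟨d, hd, h | h⟩ := exists_consecutive_change (fun r => φ c r ∈ A) hr hr' h1 h2
    · exact ⟨_, h.1, _, h.2, hcol c d hc hd, hpφ _ hc _ (by omega), hpφ _ hc _ hd⟩
    · exact ⟨_, h.2, _, h.1, (hcol c d hc hd).symm, hpφ _ hc _ hd, hpφ _ hc _ (by omega)⟩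
  obtain ⟨⟨c₁, hc₁, h₁⟩, c₂, hc₂, h₂⟩ := exists_full_columns (by omega) (fun c r => φ c r ∈ A) _
    hcol' (hcard p hp) (by omega) hA1 hA2
  -- Each row joins a column inside `A` to one outside, so all `n` rows are crossed, against the
  -- bound `k * (t + 1)`.
  have hrows := Finset.card_le_card (s := Finset.range n) (t := (Finset.range n).filter
      fun c => ∃ x ∈ A, ∃ y, y ∉ A ∧ G.Adj x y ∧ q x = c ∧ q y = c) (by
    intro r hr
    refine Finset.mem_filter.2 ⟨hr, ?_⟩
    rw [Finset.mem_range] at hr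
    obtain ⟨d, hd, h | h⟩ := exists_consecutive_change (fun c => φ c r ∈ A) hc₁ hc₂ (h₁ r hr)
      (h₂ r hr)
    · exact ⟨_, h.1, _, h.2, hrow d r hd hr, hqφ _ (by omega) _ hr, hqφ _ hd _ hr⟩
    · exact ⟨_, h.2, _, h.1, (hrow d r hd hr).symm, hqφ _ hd _ hr, hqφ _ (by omega) _ hr⟩)
  have := hcard q hq
  rw [Finset.card_range] at hrows
  omega

/-! ### Walks and adjacency in graph powers -/

namespace SimpleGraph

theorem edist_le_iff_exists_walk {V : Type*} {G : SimpleGraph V} {u v : V} {k : ℕ} :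
    G.edist u v ≤ k ↔ ∃ p : G.Walk u v, p.length ≤ k := by
  constructor
  · intro h
    obtain ⟨p, hp⟩ := SimpleGraph.exists_walk_of_edist_ne_top
      (ne_top_of_le_ne_top (ENat.natCast_ne_top k) h)
    exact ⟨p, by rw [← hp] at h; exact_mod_cast h⟩
  · rintro ⟨p, hp⟩
    exact p.edist_le.trans (by exact_mod_cast hp)

theorem Walk.lipschitz {V : Type*} {G : SimpleGraph V} {F : V → ℕ} {L : ℕ}
    (hF : ∀ u v, G.Adj u v → F u ≤ F v + L) {u v : V} (p : G.Walk u v) :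
    F u ≤ F v + p.length * L := by
  induction p with
  | nil => simp
  | cons h p ih =>
    rw [Walk.length_cons, add_mul]
    have := hF _ _ h
    omega

end SimpleGraph

/-- Supplies the nonadjacencies in powers: a coordinate that is Lipschitz along edges stays so, with
constant multiplied by `k`. -/
theorem graphPower_lipschitz {V : Type*} {G : SimpleGraph V} {F : V → ℕ} {L k : ℕ}
    (hF : ∀ u v, G.Adj u v → F u ≤ F v + L) {u v : V} (h : (graphPower G k).Adj u v) :
    F u ≤ F v + k * L := by
  obtain ⟨p, hp⟩ := SimpleGraph.edist_le_iff_exists_walk.1 h.2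
  exact (p.lipschitz hF).trans (Nat.add_le_add_left (Nat.mul_le_mul_right _ hp) _)

theorem graphPower_adj_of_adj {V : Type*} {G : SimpleGraph V} {k : ℕ} (hk : 0 < k) {u v : V}
    (h : G.Adj u v) : (graphPower G k).Adj u v :=
  ⟨h.ne, SimpleGraph.edist_le_iff_exists_walk.2 ⟨h.toWalk, by simpa using Nat.succ_le_of_lt hk⟩⟩

theorem pathGraph_power_adj {n j : ℕ} (u v : Fin n) :
    (graphPower (SimpleGraph.pathGraph n) j).Adj u v ↔
      u ≠ v ∧ (u : ℕ) ≤ v + j ∧ (v : ℕ) ≤ u + j := by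
  constructor
  · intro h
    have hF : ∀ u v : Fin n, (SimpleGraph.pathGraph n).Adj u v → (u : ℕ) ≤ v + 1 := by
      intro u v h
      rw [SimpleGraph.pathGraph_adj] at h
      omega
    have h1 := graphPower_lipschitz hF h
    have h2 := graphPower_lipschitz hF h.symm
    exact ⟨h.1, by omega⟩
  · have key : ∀ d u (hu : u + d < n),
        ∃ p : (SimpleGraph.pathGraph n).Walk ⟨u, by omega⟩ ⟨u + d, hu⟩, p.length = d := by
      intro d
      induction d with
      | zero => exact fun u hu => ⟨.nil, rfl⟩
      | succ d ih =>
        intro u hu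
        obtain ⟨p, hp⟩ := ih u (by omega)
        refine ⟨p.concat (SimpleGraph.pathGraph_adj.2 (Or.inl rfl)), ?_⟩
        rw [SimpleGraph.Walk.length_concat, hp]
    rintro ⟨h1, h2, h3⟩
    refine ⟨h1, SimpleGraph.edist_le_iff_exists_walk.2 ?_⟩
    rcases le_total (u : ℕ) v with h | h
    · obtain ⟨d, hd⟩ := Nat.exists_eq_add_of_le h
      obtain ⟨p, hp⟩ := key d u (by omega)
      have hv : (⟨u + d, by omega⟩ : Fin n) = v := Fin.ext hd.symm
      exact ⟨p.copy rfl hv, by rw [SimpleGraph.Walk.length_copy]; omega⟩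
    · obtain ⟨d, hd⟩ := Nat.exists_eq_add_of_le h
      obtain ⟨p, hp⟩ := key d v (by omega)
      have hv : (⟨v + d, by omega⟩ : Fin n) = u := Fin.ext hd.symm
      exact ⟨(p.copy rfl hv).reverse, by
        rw [SimpleGraph.Walk.length_reverse, SimpleGraph.Walk.length_copy]; omega⟩

/-! ### Path powers and unit interval graphs -/

/-- Powers of graphs on `Fin n` whose edges contain a chain of half graphs, drawn in columns of
height `m`, and join only vertices at distance at most `m`. -/
theorem lt_cliqueWidth_graphPower_of_columns {K k m n : ℕ} (hk : 0 < k) (hm : 6 * K * K < m)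
    (hn : n = (9 * K + 4) * k * m) (G : SimpleGraph (Fin n))
    (hG : ∀ u v, G.Adj u v → (u : ℕ) ≤ v + m)
    (hadj : ∀ u v : Fin n, (u : ℕ) / m + 1 = v / m → (v : ℕ) ≤ u + m → G.Adj u v) :
    K < cliqueWidth (graphPower G k) := by
  by_contra! hK
  have hm0 : 0 < m := by omega
  have hn0 : 0 < n := by rw [hn]; positivity
  have : Nonempty (Fin n) := ⟨⟨0, hn0⟩⟩
  obtain ⟨e, ⟨g⟩⟩ := exists_expr_cliqueWidth (graphPower G k)
  -- The first edge drops from row `r` to `r'`, and the rest stay in row `r'`.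
  have hwalk : ∀ d c r r', (hd : 0 < d) → (hr : r < m) → (hr' : r' ≤ r) →
      (hv : (c + d) * m + r' < n) → (hu : c * m + r < n) →
      ∃ p : G.Walk ⟨c * m + r, hu⟩ ⟨(c + d) * m + r', hv⟩, p.length = d := by
    have hedge : ∀ c r r', (hr : r < m) → (hr' : r' ≤ r) → (hv : (c + 1) * m + r' < n) →
        (hu : c * m + r < n) → G.Adj ⟨c * m + r, hu⟩ ⟨(c + 1) * m + r', hv⟩ := by
      intro c r r' hr hr' hv hu
      refine hadj _ _ ?_ ?_
      · change (c * m + r) / m + 1 = ((c + 1) * m + r') / m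
        rw [Nat.mul_comm, Nat.mul_add_div hm0, Nat.mul_comm, Nat.mul_add_div hm0,
          Nat.div_eq_of_lt hr, Nat.div_eq_of_lt (by omega)]
      · change (c + 1) * m + r' ≤ c * m + r + m
        rw [add_mul]
        omega
    intro d
    induction d with
    | zero => intro c r r' hd; omega
    | succ d ih =>
      intro c r r' _ hr hr' hv hu
      rcases Nat.eq_zero_or_pos d with rfl | hd
      · exact ⟨(hedge c r r' hr hr' hv hu).toWalk, rfl⟩
      · have hlt : (c + d) * m + r' < n := by
          have : (c + (d + 1)) * m = (c + d) * m + m := by ring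
          omega
        obtain ⟨p, hp⟩ := ih c r r' hd hr hr' hlt hu
        refine ⟨p.concat (hedge (c + d) r' r' (by omega) le_rfl hv hlt), ?_⟩
        rw [SimpleGraph.Walk.length_concat, hp]
  have hlt : ∀ c < 9 * K + 4, ∀ r < m, c * (k * m) + r < n := by
    intro c hc r hr
    have h1 : (c + 1) * (k * m) ≤ (9 * K + 4) * (k * m) := Nat.mul_le_mul_right _ hc
    have h2 : m ≤ k * m := Nat.le_mul_of_pos_left _ hk
    rw [hn, mul_assoc]
    rw [add_mul] at h1
    omega
  -- Only every `k`-th column is used, so `L = k * m`: a walk of length `k` advances exactly one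
  -- chosen column if `r' ≤ r`, and cannot reach that far if `r < r'`. The reduction modulo `n` only
  -- makes `φ` total; it never wraps in the range used.
  have hmain := le_of_halfGraph_chain e g (M := 9 * K + 4) (m := m) (L := k * m) hm0
    (Nat.le_mul_of_pos_left _ hk) (fun v => v) (fun u v h => graphPower_lipschitz hG h)
    (fun c r => ⟨(c * (k * m) + r) % n, Nat.mod_lt _ hn0⟩)
    (fun c hc r hr => Nat.mod_eq_of_lt (hlt c hc r hr)) (by
      intro c r r' hc hr hr'
      have h1 := hlt c (by omega) r hr
      have h2 := hlt (c + 1) hc r' (by omega)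
      simp only [Nat.mod_eq_of_lt h1, Nat.mod_eq_of_lt h2]
      have e1 : c * (k * m) + r = c * k * m + r := by ring
      have e2 : (c + 1) * (k * m) + r' = (c * k + k) * m + r' := by ring
      simp only [e1, e2] at h1 h2 ⊢
      obtain ⟨p, hp⟩ := hwalk k (c * k) r r' hk hr hr' h2 h1
      refine ⟨fun h => ?_, SimpleGraph.edist_le_iff_exists_walk.2 ⟨p, hp.le⟩⟩
      have h3 := Fin.mk.inj_iff.1 h
      have h4 : m ≤ k * m := Nat.le_mul_of_pos_left _ hk
      rw [add_mul] at h3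
      omega) (by omega)
  have h2 : 6 * cliqueWidth (graphPower G k) * cliqueWidth (graphPower G k) ≤ 6 * K * K := by
    gcongr
  omega

theorem lt_cliqueWidth_graphPower_pathPower {K k : ℕ} (hk : 0 < k) :
    K < cliqueWidth (graphPower (graphPower (SimpleGraph.pathGraph
      ((9 * K + 4) * k * (6 * K * K + 1))) (6 * K * K + 1)) k) := by
  refine lt_cliqueWidth_graphPower_of_columns hk (Nat.lt_add_one _) rfl _
    (fun u v h => ((pathGraph_power_adj u v).1 h).2.1) fun u v h1 h2 => ?_
  have h3 : (u : ℕ) < v := by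
    by_contra! h
    have := Nat.div_le_div_right (c := 6 * K * K + 1) h
    omega
  exact (pathGraph_power_adj u v).2 ⟨fun h => by simp [h] at h3, by omega, h2⟩

/-- Left endpoints `v / j` turn distance at most `j` into distance at most `1`. -/
theorem isUnitIntervalGraph_pathPower (n j : ℕ) (hj : 0 < j) :
    IsUnitIntervalGraph (graphPower (SimpleGraph.pathGraph n) j) := by
  refine ⟨fun v => (v : ℕ) / (j : ℝ), fun u v => ?_⟩
  have hj' : (0 : ℝ) < j := by exact_mod_cast hj
  have key : ∀ x y : ℕ, ((x : ℝ) / j ≤ y / j + 1) ↔ x ≤ y + j := by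
    intro x y
    rw [div_add_one hj'.ne', div_le_div_iff_of_pos_right hj']
    exact_mod_cast Iff.rfl
  rw [pathGraph_power_adj, Set.Icc_inter_Icc, Set.nonempty_Icc, sup_le_iff, le_inf_iff, le_inf_iff]
  simp only [key]
  refine and_congr_right fun _ => ?_
  omega

/-! ### Bipartite permutation graphs -/

/-- A graph whose edges are the inversions between two linear orders is a permutation graph. -/
theorem isPermutationGraph_of_keys {V : Type} [Finite V] (G : SimpleGraph V) (p q : V → ℤ)
    (hp : Function.Injective p) (hq : Function.Injective q)
    (h : ∀ u v, G.Adj u v ↔ (q u - q v) * (p u - p v) < 0) : IsPermutationGraph G := by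
  have sort : ∀ p : V → ℤ, Function.Injective p →
      ∃ v : Fin (Nat.card V) ≃ V, ∀ i j, i < j ↔ p (v i) < p (v j) := by
    intro p hp
    have := Fintype.ofFinite V
    let : LinearOrder V := LinearOrder.lift' p hp
    let o := Fintype.orderIsoFinOfCardEq V (Nat.card_eq_fintype_card (α := V)).symm
    exact ⟨o.toEquiv, fun i j => (o.lt_iff_lt (x := i) (y := j)).symm⟩
  obtain ⟨v, hv⟩ := sort p hp
  obtain ⟨w, hw⟩ := sort q hq
  -- Vertices are enumerated by `p`, and the permutation sends the rank under `p` to the rank under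
  -- `q`.
  refine ⟨Nat.card V, v, v.trans w.symm, fun i j => ?_⟩
  have hw' : ∀ i j, (w.symm (v i) < w.symm (v j) ↔ q (v i) < q (v j)) := fun i j => by
    rw [hw, w.apply_symm_apply, w.apply_symm_apply]
  have e1 := hv i j
  have e2 := hv j i
  have e3 := hw' i j
  have e4 := hw' j i
  rw [h, mul_neg_iff, mul_neg_iff]
  simp only [Equiv.trans_apply]
  rw [Fin.lt_def] at e1 e2 e3 e4
  omega

/-- The bipartite graph on `Fin n` in which vertices at distance at most `m` are adjacent when
they lie in columns of different parity, the columns being intervals of length `m`. -/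
def bipartitePathPower (n m : ℕ) : SimpleGraph (Fin n) where
  Adj u v := (u : ℕ) / m % 2 ≠ v / m % 2 ∧ (u : ℕ) ≤ v + m ∧ (v : ℕ) ≤ u + m
  symm := ⟨fun _ _ h => ⟨h.1.symm, h.2.2, h.2.1⟩⟩
  loopless := ⟨fun _ h => h.1 rfl⟩

theorem bipartitePathPower_isBipartite (n m : ℕ) : (bipartitePathPower n m).IsBipartite :=
  ⟨SimpleGraph.Coloring.mk (fun u => (⟨(u : ℕ) / m % 2, Nat.mod_lt _ two_pos⟩ : Fin 2))
    fun h he => h.1 (Fin.mk.inj_iff.1 he)⟩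

/-- The keys are `4u` shifted by `2m + 1`, in opposite directions for the two keys and for the two
parities. Equal parity gives no inversion; for different parities the key differences are `4(u - v)
± (4m + 2)`, of opposite sign exactly when `|u - v| ≤ m`. They never vanish, being `2` modulo `4`.
-/
theorem bipartitePathPower_isPermutationGraph (n m : ℕ) :
    IsPermutationGraph (bipartitePathPower n m) := by
  have hmod : ∀ u : Fin n, (u : ℕ) / m % 2 = 0 ∨ (u : ℕ) / m % 2 = 1 := fun u =>
    Nat.mod_two_eq_zero_or_one _
  refine isPermutationGraph_of_keys _
    (fun u => 4 * (u : ℕ) + if (u : ℕ) / m % 2 = 0 then 2 * (m : ℤ) + 1 else -(2 * m + 1))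
    (fun u => 4 * (u : ℕ) - if (u : ℕ) / m % 2 = 0 then 2 * (m : ℤ) + 1 else -(2 * m + 1))
    ?_ ?_ ?_
  · intro u v h
    ext
    rcases hmod u with hu | hu <;> rcases hmod v with hv | hv <;> simp [hu, hv] at h <;> omega
  · intro u v h
    ext
    rcases hmod u with hu | hu <;> rcases hmod v with hv | hv <;> simp [hu, hv] at h <;> omega
  · intro u v
    change ((u : ℕ) / m % 2 ≠ v / m % 2 ∧ (u : ℕ) ≤ v + m ∧ (v : ℕ) ≤ u + m) ↔ _
    rw [mul_neg_iff]
    rcases hmod u with hu | hu <;> rcases hmod v with hv | hv <;>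
      simp only [hu, hv, if_true, one_ne_zero, if_false] <;> omega

/-- Consecutive columns have different parity, so deleting edges between columns of equal parity
leaves the half graphs intact. -/
theorem lt_cliqueWidth_graphPower_bipartitePathPower {K k : ℕ} (hk : 0 < k) :
    K < cliqueWidth (graphPower (bipartitePathPower
      ((9 * K + 4) * k * (6 * K * K + 1)) (6 * K * K + 1)) k) := by
  refine lt_cliqueWidth_graphPower_of_columns hk (Nat.lt_add_one _) rfl _
    (fun u v h => h.2.1) fun u v h1 h2 => ?_
  have h3 : (u : ℕ) < v := by
    by_contra! h
    have := Nat.div_le_div_right (c := 6 * K * K + 1) h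
    omega
  exact ⟨by omega, by omega, h2⟩

/-! ### Hypercubes -/

open Finset in
/-- Between adjacent vertices of the hypercube, the number of ones among given coordinates changes
by at most one. -/
theorem hypercubeGraph_card_filter_le {d : ℕ} (s : Finset (Fin d)) (u v : Fin d → Bool)
    (h : (hypercubeGraph d).Adj u v) :
    (s.filter fun i => u i = true).card ≤ (s.filter fun i => v i = true).card + 1 := by
  have h1 : (univ.filter fun i => u i ≠ v i).card = 1 := h
  have hsub : (s.filter fun i => u i = true) ⊆
      (s.filter fun i => v i = true) ∪ univ.filter fun i => u i ≠ v i := by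
    intro i hi
    simp only [mem_filter, mem_union, mem_univ, true_and] at hi ⊢
    by_cases hv : v i = true
    · exact Or.inl ⟨hi.1, hv⟩
    · exact Or.inr fun he => hv (he ▸ hi.2)
  exact (card_le_card hsub).trans ((card_union_le _ _).trans (by rw [h1]))

theorem hypercubeGraph_adj_of_forall {d : ℕ} {u v : Fin d → Bool} (j : Fin d)
    (hj : u j ≠ v j) (h : ∀ i, i ≠ j → u i = v i) : (hypercubeGraph d).Adj u v := by
  change (Finset.univ.filter fun i => u i ≠ v i).card = 1
  rw [Finset.card_eq_one]
  refine ⟨j, ?_⟩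
  ext i
  simp only [Finset.mem_filter, Finset.mem_univ, true_and, Finset.mem_singleton]
  exact ⟨fun hi => by_contra fun hij => hi (h i hij), fun hi => hi ▸ hj⟩

/-- Grid point `(x, y)` has ones in the first `x` places of the first half and the first `y` of the
second. Counting ones in each half recovers the coordinates, and these counts change by at most `k`
along an edge of the power. -/
theorem lt_cliqueWidth_graphPower_hypercubeGraph {K k n : ℕ} (hk : 0 < k)
    (hn : 3 * (K * (k + 1)) + 1 < n) :
    K < cliqueWidth (graphPower (hypercubeGraph (2 * n)) k) := by
  by_contra! hK
  obtain ⟨e, ⟨g⟩⟩ := exists_expr_cliqueWidth (graphPower (hypercubeGraph (2 * n)) k)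
  have hcount : ∀ a x, x ≤ n → a + n ≤ 2 * n →
      (Finset.univ.filter fun i : Fin (2 * n) => a ≤ (i : ℕ) ∧ (i : ℕ) < a + x).card = x := by
    intro a x hx ha
    rw [← Finset.card_map Fin.valEmbedding]
    have : (Finset.univ.filter fun i : Fin (2 * n) =>
        a ≤ (i : ℕ) ∧ (i : ℕ) < a + x).map Fin.valEmbedding = Finset.Ico a (a + x) := by
      ext i
      simp only [Finset.mem_map, Finset.mem_filter, Finset.mem_univ, true_and, Finset.mem_Ico,
        Fin.valEmbedding_apply]
      constructor
      · rintro ⟨j, hj, rfl⟩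
        exact hj
      · intro hi
        exact ⟨⟨i, by omega⟩, hi, rfl⟩
    rw [this, Nat.card_Ico]
    omega
  have hmain := le_of_grid e g (n := n) (t := k)
    (fun x y i => decide ((i : ℕ) < x ∨ (n ≤ (i : ℕ) ∧ (i : ℕ) < n + y)))
    (fun u => ((Finset.univ.filter fun i : Fin (2 * n) => (i : ℕ) < n).filter
      fun i => u i = true).card)
    (fun u => ((Finset.univ.filter fun i : Fin (2 * n) => n ≤ (i : ℕ)).filter
      fun i => u i = true).card)
    (fun u v h => by simpa using graphPower_lipschitz (hypercubeGraph_card_filter_le _) h)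
    (fun u v h => by simpa using graphPower_lipschitz (hypercubeGraph_card_filter_le _) h)
    (fun x hx y hy => by
      refine Eq.trans ?_ (hcount 0 x hx.le (by omega))
      rw [Finset.filter_filter]
      congr 1
      refine Finset.filter_congr fun i _ => ?_
      simp only [decide_eq_true_eq]
      omega)
    (fun x hx y hy => by
      refine Eq.trans ?_ (hcount n y hy.le (by omega))
      rw [Finset.filter_filter]
      congr 1
      refine Finset.filter_congr fun i _ => ?_
      simp only [decide_eq_true_eq]
      omega)
    (fun x y hx hy => graphPower_adj_of_adj hk <| hypercubeGraph_adj_of_forall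
      ⟨x, by omega⟩ (by
        simp only [ne_eq, decide_eq_decide]
        omega) (fun i hi => by
        have : (i : ℕ) ≠ x := fun h => hi (Fin.ext h)
        simp only [decide_eq_decide]
        omega))
    (fun x y hx hy => graphPower_adj_of_adj hk <| hypercubeGraph_adj_of_forall
      ⟨n + y, by omega⟩ (by
        simp only [ne_eq, decide_eq_decide]
        omega) (fun i hi => by
        have : (i : ℕ) ≠ n + y := fun h => hi (Fin.ext h)
        simp only [decide_eq_decide]
        omega))
  have h2 : cliqueWidth (graphPower (hypercubeGraph (2 * n)) k) * (k + 1) ≤ K * (k + 1) :=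
    Nat.mul_le_mul_right _ hK
  omega

theorem mainTheorem5 :
    bipartitePermutationGraphs.IsPowerUnboundedCliqueWidth ∧
    pathPowers.IsPowerUnboundedCliqueWidth ∧
    unitIntervalGraphs.IsPowerUnboundedCliqueWidth ∧
    hypercubeGraphs.IsPowerUnboundedCliqueWidth := by
  have hpos : ∀ k K : ℕ, 0 < k → 0 < (9 * K + 4) * k * (6 * K * K + 1) := by
    intro k K hk
    positivity
  refine ⟨?_, ?_, ?_, ?_⟩ <;>
    refine GraphClass.isPowerUnboundedCliqueWidth_of_forall _ fun k K hk => ?_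
  · exact ⟨_, inferInstance, ⟨⟨0, hpos k K hk⟩⟩, _,
      ⟨bipartitePathPower_isBipartite _ _, bipartitePathPower_isPermutationGraph _ _⟩,
      lt_cliqueWidth_graphPower_bipartitePathPower hk⟩
  · exact ⟨_, inferInstance, ⟨⟨0, hpos k K hk⟩⟩, _,
      ⟨_, _, hpos k K hk, Nat.succ_pos _, ⟨SimpleGraph.Iso.refl⟩⟩,
      lt_cliqueWidth_graphPower_pathPower hk⟩
  · exact ⟨_, inferInstance, ⟨⟨0, hpos k K hk⟩⟩, _,
      isUnitIntervalGraph_pathPower _ _ (Nat.succ_pos _),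
      lt_cliqueWidth_graphPower_pathPower hk⟩
  · exact ⟨_, inferInstance, inferInstance, _,
      ⟨2 * (3 * (K * (k + 1)) + 2), by omega, ⟨SimpleGraph.Iso.refl⟩⟩,
      lt_cliqueWidth_graphPower_hypercubeGraph hk (by omega)⟩
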